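/- Let $A\in\mathbb R^{n\times m}$ ($n,m\ge 1$) be the payoff matrix of a two-player zero-sum game: Player 1 chooses a row and maximizes $x^\top Ay$, Player 2 chooses a column and minimizes it, with mixed strategies $x\in S_n$, $y\in S_m$, where $S_k$ is the probability simplex in $\mathbb R^k$. Write $c_1,\dots,c_m$ for the columns of $A$, let $v=\max_{x\in S_n}\min_{y\in S_m}x^\top Ay$ be the value of the game, and let $\mathrm{NE}_1\subseteq S_n$ be the set of all $x$ that belong to some Nash equilibrium (saddle point) $(x,y)$. Assume: - (A1) $\mathrm{NE}_1$ has positive measure, that is, its image under $(x_1,\dots,x_n)\mapsto(x_1,\dots,x_{n-1})$ has positive Lebesgue measure in $\mathbb R^{n-1}$; - (A2) $\mathrm{NE}_1\cap\partial S_n=\emptyset$, where $\partial S_n$ is the boundary of $S_n$ relative to its affine hull; - $c_1=v\,\mathbf 1_n$. For $j\in\{1,\dots,m\}$ let $X_j=\{x\in S_n: c_j^\top x\le c_k^\top x \text{ for all } k\}$, and for $I\subseteq\{1,\dots,m\}$ let $B_I=\bigcap_{i\in I}X_i\cap\bigcap_{j\notin I}(S_n\setminus X_j)$, the set of $x\in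 S_n$ to which Player 2's set of pure best responses is exactly $I$. Let $1\in I$ and $|I|\ge 2$, and suppose that there is an index $l\in\{1,\dots,n\}$ such that every $w\in\mathrm{conv}\{c_i: i\in I\setminus\{1\}\}$ satisfies $w_l<\max_{1\le j\le n}w_j$. Consider any fictitious play in which Player 1 starts without a prior, that is, sequences $(\hat x(k))_{k\ge0}$ in $\mathbb R^n$ and $(\hat y(k))_{k\ge0}$ in $\mathbb R^m$ and a real $k_2\ge 0$ such that $\hat x(0)=0$; $\hat y(0)\in S_m$ if $k_2>0$ and $\hat y(0)=0$ if $k_2=0$; and for all $k\ge 0$ $$\hat x(k+1)=\frac{k\,\hat x(k)+e_{p_k}}{k+1},\qquad \hat y(k+1)=\frac{(k+k_2)\,\hat y(k)+e_{q_k}}{k+k_2+1},$$ with $p_k\in\arg\max_{i}\,(A\hat y(k))_i$ and $q_k\in\arg\min_{j}\,c_j^\top\hat x(k)$, ties being broken arbitrarily. Then $\hat x(k)$ does not converge to any point $x^*\in B_I$. -/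

import Mathlib

open Matrix

noncomputable section

namespace ZeroSum

/-- The coordinate map `(x₁, …, x_{n+1}) ↦ (x₁, …, x_n)`, which identifies the affine hull of the
simplex with `n + 1` vertices with `ℝⁿ`. -/
def coordMap (n : ℕ) (x : Fin (n + 1) → ℝ) : Fin n → ℝ := fun i => x i.castSucc

/-- The measure of a set of mixed strategies: the Lebesgue measure of its image in `ℝⁿ`. -/
def simplexMeasure {n : ℕ} (S : Set (Fin (n + 1) → ℝ)) : ENNReal :=
  MeasureTheory.volume (coordMap n '' S)

/-- The largest coordinate of a vector. -/
def maxCoord {n : ℕ} (w : Fin (n + 1) → ℝ) : ℝ :=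
  Finset.univ.sup' Finset.univ_nonempty w

variable {n m : ℕ}

/-- Player 1's expected payoff `xᵀ A y`; Player 2's is its negative. -/
def payoff (A : Matrix (Fin (n + 1)) (Fin (m + 1)) ℝ)
    (x : Fin (n + 1) → ℝ) (y : Fin (m + 1) → ℝ) : ℝ :=
  x ⬝ᵥ (A *ᵥ y)

/-- `(x, y)` is a mixed Nash equilibrium, i.e. a saddle point of the payoff. -/
structure IsNash (A : Matrix (Fin (n + 1)) (Fin (m + 1)) ℝ)
    (x : Fin (n + 1) → ℝ) (y : Fin (m + 1) → ℝ) : Prop where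
  mem_left : x ∈ stdSimplex ℝ (Fin (n + 1))
  mem_right : y ∈ stdSimplex ℝ (Fin (m + 1))
  left_optimal : ∀ x' ∈ stdSimplex ℝ (Fin (n + 1)), payoff A x' y ≤ payoff A x y
  right_optimal : ∀ y' ∈ stdSimplex ℝ (Fin (m + 1)), payoff A x y ≤ payoff A x y'

/-- The equilibrium strategies of Player 1. -/
def nashSet₁ (A : Matrix (Fin (n + 1)) (Fin (m + 1)) ℝ) : Set (Fin (n + 1) → ℝ) :=
  {x | ∃ y, IsNash A x y}

/-- The value `max_x min_y xᵀ A y` of the game. -/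
def gameValue (A : Matrix (Fin (n + 1)) (Fin (m + 1)) ℝ) : ℝ :=
  ⨆ x : stdSimplex ℝ (Fin (n + 1)), ⨅ y : stdSimplex ℝ (Fin (m + 1)),
    payoff A (x : Fin (n + 1) → ℝ) (y : Fin (m + 1) → ℝ)

/-- The column `c_j` of the payoff matrix. -/
def column (A : Matrix (Fin (n + 1)) (Fin (m + 1)) ℝ) (j : Fin (m + 1)) : Fin (n + 1) → ℝ :=
  fun i => A i j

/-- The pure best responses of Player 1 to `y`; all actions if `y = 0`. -/
def bestResponse₁ (A : Matrix (Fin (n + 1)) (Fin (m + 1)) ℝ) (y : Fin (m + 1) → ℝ) :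
    Set (Fin (n + 1)) :=
  {i | ∀ i', (A *ᵥ y) i' ≤ (A *ᵥ y) i}

/-- The pure best responses of Player 2 to `x`; all actions if `x = 0`. -/
def bestResponse₂ (A : Matrix (Fin (n + 1)) (Fin (m + 1)) ℝ) (x : Fin (n + 1) → ℝ) :
    Set (Fin (m + 1)) :=
  {j | ∀ j', column A j ⬝ᵥ x ≤ column A j' ⬝ᵥ x}

/-- The polyhedral region `X_j` of the strategies of Player 1 to which `j` is a best response. -/
def regionX (A : Matrix (Fin (n + 1)) (Fin (m + 1)) ℝ) (j : Fin (m + 1)) :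
    Set (Fin (n + 1) → ℝ) :=
  {x | x ∈ stdSimplex ℝ (Fin (n + 1)) ∧ ∀ j', column A j ⬝ᵥ x ≤ column A j' ⬝ᵥ x}

/-- The region `B_I` of the strategies of Player 1 to which the best-response set is exactly `I`. -/
def regionB (A : Matrix (Fin (n + 1)) (Fin (m + 1)) ℝ) (I : Finset (Fin (m + 1))) :
    Set (Fin (n + 1) → ℝ) :=
  {x | x ∈ stdSimplex ℝ (Fin (n + 1)) ∧ (∀ i ∈ I, x ∈ regionX A i) ∧ ∀ j ∉ I, x ∉ regionX A j}

/-- `(x k, y k)` is a trajectory of fictitious play with prior weights `k₁`, `k₂`. At each step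
the actions are arbitrary best responses, so every tie-breaking rule is covered. -/
structure IsFictitiousPlay (A : Matrix (Fin (n + 1)) (Fin (m + 1)) ℝ) (k₁ k₂ : ℝ)
    (x : ℕ → Fin (n + 1) → ℝ) (y : ℕ → Fin (m + 1) → ℝ) : Prop where
  nonneg₁ : 0 ≤ k₁
  nonneg₂ : 0 ≤ k₂
  init_zero₁ : k₁ = 0 → x 0 = 0
  init_zero₂ : k₂ = 0 → y 0 = 0
  init_pos₁ : 0 < k₁ → x 0 ∈ stdSimplex ℝ (Fin (n + 1))
  init_pos₂ : 0 < k₂ → y 0 ∈ stdSimplex ℝ (Fin (m + 1))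
  step₁ : ∀ k : ℕ, ∃ p ∈ bestResponse₁ A (y k),
    x (k + 1) = ((k : ℝ) + k₁ + 1)⁻¹ • (((k : ℝ) + k₁) • x k + Pi.single p (1 : ℝ))
  step₂ : ∀ k : ℕ, ∃ q ∈ bestResponse₂ A (x k),
    y (k + 1) = ((k : ℝ) + k₂ + 1)⁻¹ • (((k : ℝ) + k₂) • y k + Pi.single q (1 : ℝ))

/-- Player 1's equilibrium set has positive measure. -/
def PositiveMeasure (A : Matrix (Fin (n + 1)) (Fin (m + 1)) ℝ) : Prop :=
  0 < simplexMeasure (nashSet₁ A)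

/-- Every equilibrium strategy of Player 1 is fully mixed: the equilibrium set misses the
boundary of the simplex (relative to its affine hull). -/
def FullyMixed (A : Matrix (Fin (n + 1)) (Fin (m + 1)) ℝ) : Prop :=
  intrinsicFrontier ℝ (stdSimplex ℝ (Fin (n + 1))) ∩ nashSet₁ A = ∅

end ZeroSum

end

/-!
Sum up the payoffs that Player 1's actions would have earned so far. Player 1 always plays a leader
of this sum, so an equal payoff for all actions in a round does not change who leads. If `x k`
converges to a point of `B_I`, then Player 2 eventually plays only columns of `I`.

* If columns of `I` other than the constant column `v` recur, their sum is a growing multiple of a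
  point of their convex hull, a compact set on which the coordinate `l` trails the maximum by at
  least some `δ > 0`. Hence `l` eventually stops being a leader.
* Otherwise only the constant column is played after some last round `t` with another column `c`
  (there is such a round because `x 1` is a vertex, hence no equilibrium strategy), and the leaders
  are frozen. They cannot be all the actions: this would make the action `p t` a minimal coordinate
  of `c`, while the switch away from `c` forces `v ≤ c (p t)`. So `v ≤ c` everywhere although
  `c ⬝ᵥ x t ≤ v`, which makes `x t` an equilibrium strategy and, since that is fully mixed, `c`
  equal to `v`.

In both cases some action is played only finitely often, so its weight in the limit is zero. But the
limit is an equilibrium strategy, hence fully mixed.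
-/

open Filter Topology

namespace ZeroSum

section Simplex

variable {ι : Type*} [Fintype ι] {x : ι → ℝ}

lemma const_dotProduct_of_mem_stdSimplex (hx : x ∈ stdSimplex ℝ ι) (v : ℝ) :
    (fun _ => v) ⬝ᵥ x = v := by
  rw [dotProduct, ← Finset.mul_sum, hx.2, mul_one]

lemma le_dotProduct_of_mem_stdSimplex (hx : x ∈ stdSimplex ℝ ι) {c : ι → ℝ} {v : ℝ}
    (hc : ∀ i, v ≤ c i) : v ≤ c ⬝ᵥ x :=
  (const_dotProduct_of_mem_stdSimplex hx v).symm.trans_le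
    (dotProduct_le_dotProduct_of_nonneg_right hc hx.1)

lemma eq_const_of_dotProduct_le (hx : x ∈ stdSimplex ℝ ι) (hpos : ∀ i, 0 < x i) {c : ι → ℝ}
    {v : ℝ} (hc : ∀ i, v ≤ c i) (hcx : c ⬝ᵥ x ≤ v) : c = fun _ => v := by
  by_contra hne
  obtain ⟨i, hi⟩ := Function.ne_iff.1 hne
  have hlt : (fun _ => v) ⬝ᵥ x < c ⬝ᵥ x :=
    Finset.sum_lt_sum (fun j _ => mul_le_mul_of_nonneg_right (hc j) (hx.1 j))
      ⟨i, Finset.mem_univ i, mul_lt_mul_of_pos_right ((hc i).lt_of_ne' hi) (hpos i)⟩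
  rw [const_dotProduct_of_mem_stdSimplex hx] at hlt
  exact hlt.not_ge hcx

lemma eventually_lineMap_mem_of_mem_intrinsicInterior {V P : Type*} [AddCommGroup V] [Module ℝ V]
    [TopologicalSpace V] [ContinuousSMul ℝ V] [AddTorsor V P] [TopologicalSpace P]
    [IsTopologicalAddTorsor P] {s : Set P} {a b : P} (ha : a ∈ intrinsicInterior ℝ s)
    (hb : b ∈ s) : ∀ᶠ t in 𝓝 (0 : ℝ), AffineMap.lineMap a b t ∈ s := by
  obtain ⟨a, ha, rfl⟩ := mem_intrinsicInterior.1 ha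
  let line (t : ℝ) : affineSpan ℝ s :=
    ⟨AffineMap.lineMap (a : P) b t, AffineMap.lineMap_mem t a.2 (subset_affineSpan ℝ s hb)⟩
  have hline : Continuous line := AffineMap.lineMap_continuous.subtype_mk _
  have hline_zero : line 0 = a := Subtype.ext (AffineMap.lineMap_apply_zero _ _)
  have hline_mem : ∀ᶠ t in 𝓝 0, line t ∈ ((↑) ⁻¹' s : Set (affineSpan ℝ s)) :=
    hline.continuousAt.eventually (mem_interior_iff_mem_nhds.1 (by rwa [hline_zero]))
  exact hline_mem

lemma mem_intrinsicFrontier_stdSimplex (hx : x ∈ stdSimplex ℝ ι) {l : ι} (hl : x l = 0) :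
    x ∈ intrinsicFrontier ℝ (stdSimplex ℝ ι) := by
  classical
  rw [← intrinsicClosure_sdiff_intrinsicInterior]
  refine ⟨subset_intrinsicClosure hx, fun hint => ?_⟩
  -- Moving away from the vertex `e_l` makes the coordinate `l` negative.
  have hline := eventually_lineMap_mem_of_mem_intrinsicInterior hint (single_mem_stdSimplex ℝ l)
  obtain ⟨t, ht, htneg⟩ :=
    ((hline.filter_mono nhdsWithin_le_nhds).and (self_mem_nhdsWithin (s := Set.Iio 0))).exists
  have htl := ht.1 l
  simp only [AffineMap.lineMap_apply, vsub_eq_sub, vadd_eq_add, Pi.add_apply, Pi.smul_apply,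
    Pi.sub_apply, Pi.single_eq_same, hl, smul_eq_mul, sub_zero, mul_one, add_zero] at htl
  exact htneg.not_ge htl

end Simplex

section Gap

variable {ι κ : Type*} {C : Set (ι → ℝ)} {l : ι} {δ : ℝ}

lemma exists_pos_forall_add_le_of_isCompact [Finite ι] (hC : IsCompact C)
    (hl : ∀ w ∈ C, ∃ i, w l < w i) : ∃ δ > 0, ∀ w ∈ C, ∃ i, w l + δ ≤ w i := by
  cases nonempty_fintype ι
  have huniv : (Finset.univ : Finset ι).Nonempty := ⟨l, Finset.mem_univ l⟩
  let gap (w : ι → ℝ) : ℝ := Finset.univ.sup' huniv fun i => w i - w l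
  have hgap : Continuous gap := Continuous.finset_sup'_apply huniv fun i _ => by fun_prop
  have hgap_pos : ∀ w ∈ C, 0 < gap w := fun w hw =>
    (Finset.lt_sup'_iff huniv).2 ((hl w hw).imp fun i hi => ⟨Finset.mem_univ i, sub_pos.2 hi⟩)
  obtain ⟨δ, hδ, hle⟩ := hC.exists_forall_le' hgap.continuousOn hgap_pos
  refine ⟨δ, hδ, fun w hw => ?_⟩
  obtain ⟨i, -, hi⟩ := (Finset.le_sup'_iff huniv).1 (hle w hw)
  exact ⟨i, by linarith⟩

lemma exists_sum_add_card_mul_le (hC : Convex ℝ C) (hgap : ∀ w ∈ C, ∃ i, w l + δ ≤ w i)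
    {s : Finset κ} {c : κ → ι → ℝ} (hc : ∀ j ∈ s, c j ∈ C) :
    ∃ i, ∑ j ∈ s, c j l + s.card * δ ≤ ∑ j ∈ s, c j i := by
  rcases s.eq_empty_or_nonempty with rfl | hs
  · exact ⟨l, by simp⟩
  have hcard : (0 : ℝ) < s.card := mod_cast hs.card_pos
  have hmean : ∑ j ∈ s, (s.card : ℝ)⁻¹ • c j ∈ C :=
    hC.sum_mem (fun _ _ => by positivity)
      (by rw [Finset.sum_const, nsmul_eq_mul, mul_inv_cancel₀ hcard.ne']) hc
  obtain ⟨i, hi⟩ := hgap _ hmean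
  simp only [Finset.sum_apply, Pi.smul_apply, smul_eq_mul, ← Finset.mul_sum] at hi
  refine ⟨i, ?_⟩
  calc ∑ j ∈ s, c j l + s.card * δ
      = s.card * ((s.card : ℝ)⁻¹ * ∑ j ∈ s, c j l + δ) := by field_simp
    _ ≤ s.card * ((s.card : ℝ)⁻¹ * ∑ j ∈ s, c j i) := by gcongr
    _ = ∑ j ∈ s, c j i := by field_simp

end Gap

section Sequences

lemma tendsto_count_atTop {P : ℕ → Prop} [DecidablePred P] (hP : ∃ᶠ k in atTop, P k) :
    Tendsto (Nat.count P) atTop atTop :=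
  (Nat.count_monotone P).tendsto_atTop_atTop fun N =>
    ⟨Nat.nth P N, (Nat.count_nth_of_infinite (Nat.frequently_atTop_iff_infinite.1 hP) N).ge⟩

lemma exists_last_of_eventually_not {P : ℕ → Prop} {a : ℕ} (ha : P a)
    (hP : ∀ᶠ k in atTop, ¬ P k) : ∃ t ≥ a, P t ∧ ∀ k > t, ¬ P k := by
  have hfin : {k | P k}.Finite := by
    rw [← Set.not_infinite, ← Nat.frequently_atTop_iff_infinite]
    exact not_frequently.2 hP
  obtain ⟨t, hat, ht⟩ := hfin.exists_le_maximal ha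
  exact ⟨t, hat, ht.prop, fun k hk => ht.not_prop_of_gt hk⟩

end Sequences

section FollowTheLeader

variable {ι : Type*}

/-- Follow-the-leader play: `u k i` is the payoff that action `i` would have accumulated before
round `k`, when `c k` lists the payoffs of round `k`, and the action `p k` leads at that time. The
initial vector `u 0` is arbitrary, which accommodates priors. -/
structure IsFollowTheLeader (c u : ℕ → ι → ℝ) (p : ℕ → ι) : Prop where
  step : ∀ k, u (k + 1) = u k + c k
  best : ∀ k i, u k i ≤ u k (p k)

/-- `x k` is the mean of the vertices `e_{p 0}, …, e_{p (k - 1)}` of the simplex. The value of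
`x 0` is irrelevant. -/
def IsEmpiricalMean [DecidableEq ι] (p : ℕ → ι) (x : ℕ → ι → ℝ) : Prop :=
  ∀ k : ℕ, ((k : ℝ) + 1) • x (k + 1) = (k : ℝ) • x k + Pi.single (p k) 1

namespace IsFollowTheLeader

variable {c u : ℕ → ι → ℝ} {p : ℕ → ι}

lemma shift (h : IsFollowTheLeader c u p) (K : ℕ) :
    IsFollowTheLeader (fun k => c (k + K)) (fun k => u (k + K)) (fun k => p (k + K)) where
  step k := by rw [Nat.add_right_comm, h.step]
  best k := h.best (k + K)

lemma apply_eq_add_sum (h : IsFollowTheLeader c u p) (k : ℕ) (i : ι) :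
    u k i = u 0 i + ∑ j ∈ Finset.range k, c j i := by
  induction k with
  | zero => simp
  | succ k ih => rw [h.step, Pi.add_apply, ih, Finset.sum_range_succ, add_assoc]

lemma ne_of_apply_lt (h : IsFollowTheLeader c u p) {k : ℕ} {l i : ι} (hli : u k l < u k i) :
    p k ≠ l := by
  rintro rfl
  exact hli.not_ge (h.best k i)

lemma ne_of_forall_const (h : IsFollowTheLeader c u p) {K : ℕ}
    (hc : ∀ k ≥ K, ∀ i i', c k i = c k i') {l i : ι} (hli : u K l < u K i) :
    ∀ k ≥ K, p k ≠ l := by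
  refine fun k hk => h.ne_of_apply_lt (i := i) ?_
  induction k, hk using Nat.le_induction with
  | base => exact hli
  | succ k hk ih => simpa only [h.step, Pi.add_apply, hc k hk l i, add_lt_add_iff_right] using ih

lemma exists_apply_add_count_mul_le (h : IsFollowTheLeader c u p) {C : Set (ι → ℝ)}
    [DecidablePred fun k => c k ∈ C] (hC : Convex ℝ C) {l : ι} {δ : ℝ}
    (hgap : ∀ w ∈ C, ∃ i, w l + δ ≤ w i) (hc : ∀ k, c k ∉ C → ∀ i i', c k i = c k i') (k : ℕ) :
    ∃ i, u k l - u 0 l + Nat.count (fun j => c j ∈ C) k * δ ≤ u k i - u 0 i := by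
  obtain ⟨i, hi⟩ := exists_sum_add_card_mul_le hC hgap (c := c)
    (s := {j ∈ Finset.range k | c j ∈ C}) fun j hj => (Finset.mem_filter.1 hj).2
  have hconst : ∑ j ∈ Finset.range k with c j ∉ C, c j l
      = ∑ j ∈ Finset.range k with c j ∉ C, c j i :=
    Finset.sum_congr rfl fun j hj => hc j (Finset.mem_filter.1 hj).2 l i
  refine ⟨i, ?_⟩
  rw [h.apply_eq_add_sum k l, h.apply_eq_add_sum k i, Nat.count_eq_card_filter_range,
    ← Finset.sum_filter_add_sum_filter_not _ (fun j => c j ∈ C) fun j => c j l,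
    ← Finset.sum_filter_add_sum_filter_not _ (fun j => c j ∈ C) fun j => c j i]
  linarith

lemma eventually_ne_of_frequently_mem [Finite ι] (h : IsFollowTheLeader c u p)
    {C : Set (ι → ℝ)} (hC : Convex ℝ C) (hC' : IsCompact C) {l : ι}
    (hl : ∀ w ∈ C, ∃ i, w l < w i) (hc : ∀ᶠ k in atTop, c k ∉ C → ∀ i i', c k i = c k i')
    (hfreq : ∃ᶠ k in atTop, c k ∈ C) : ∀ᶠ k in atTop, p k ≠ l := by
  classical
  obtain ⟨δ, hδ, hgap⟩ := exists_pos_forall_add_le_of_isCompact hC' hl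
  obtain ⟨K, hK⟩ := eventually_atTop.1 hc
  rw [← map_add_atTop_eq_nat K, eventually_map]
  rw [← map_add_atTop_eq_nat K, frequently_map] at hfreq
  have hgrow : Tendsto (fun k => Nat.count (fun j => c (j + K) ∈ C) k * δ) atTop atTop :=
    (tendsto_natCast_atTop_atTop.comp (tendsto_count_atTop hfreq)).atTop_mul_const hδ
  have hlarge : ∀ᶠ k in atTop, ∀ i, u K l - u K i < Nat.count (fun j => c (j + K) ∈ C) k * δ :=
    eventually_all.2 fun i => hgrow.eventually_gt_atTop _
  filter_upwards [hlarge] with k hk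
  obtain ⟨i, hi⟩ := (h.shift K).exists_apply_add_count_mul_le hC hgap
    (fun j => hK (j + K) (Nat.le_add_left K j)) k
  rw [zero_add] at hi
  exact h.ne_of_apply_lt (i := i) (by linarith [hk i])

end IsFollowTheLeader

namespace IsEmpiricalMean

variable [DecidableEq ι] {p : ℕ → ι} {x : ℕ → ι → ℝ}

lemma apply_one (hx : IsEmpiricalMean p x) : x 1 = Pi.single (p 0) 1 := by
  simpa using hx 0

lemma mem_stdSimplex [Fintype ι] (hx : IsEmpiricalMean p x) {k : ℕ} (hk : 1 ≤ k) :
    x k ∈ stdSimplex ℝ ι := by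
  induction k, hk using Nat.le_induction with
  | base => exact hx.apply_one ▸ single_mem_stdSimplex ℝ (p 0)
  | succ k _ ih =>
    have hk : (0 : ℝ) < k + 1 := by positivity
    have hmean : x (k + 1) = (k / (k + 1) : ℝ) • x k + (1 / (k + 1) : ℝ) • Pi.single (p k) 1 := by
      rw [← inv_smul_smul₀ hk.ne' (x (k + 1)), hx k, smul_add, smul_smul, inv_mul_eq_div,
        one_div]
    rw [hmean]
    exact convex_stdSimplex ℝ ι ih (single_mem_stdSimplex ℝ (p k)) (by positivity) (by positivity)
      (by field_simp)

lemma apply_eq_zero_of_eventually_ne (hx : IsEmpiricalMean p x) {z : ι → ℝ}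
    (hlim : Tendsto x atTop (𝓝 z)) {l : ι} (hl : ∀ᶠ k in atTop, p k ≠ l) : z l = 0 := by
  obtain ⟨K, hK⟩ := eventually_atTop.1 hl
  have hconst : ∀ k ≥ K, (k : ℝ) * x k l = K * x K l := by
    intro k hk
    induction k, hk using Nat.le_induction with
    | base => rfl
    | succ k hk ih =>
      have hstep := congrFun (hx k) l
      simp only [Pi.smul_apply, smul_eq_mul, Pi.add_apply, Pi.single_eq_of_ne' (hK k hk),
        add_zero] at hstep
      rw [Nat.cast_add_one, hstep, ih]
  refine tendsto_nhds_unique (tendsto_pi_nhds.1 hlim l) ?_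
  refine (tendsto_const_div_atTop_nhds_zero_nat ((K : ℝ) * x K l)).congr' ?_
  filter_upwards [eventually_ge_atTop K, eventually_gt_atTop 0] with k hk hk0
  rw [← hconst k hk, mul_div_cancel_left₀ _ (Nat.cast_ne_zero.2 hk0.ne')]

lemma le_apply_of_dotProduct_le [Fintype ι] (hx : IsEmpiricalMean p x) {c : ι → ℝ} {v : ℝ} {t : ℕ}
    (hle : c ⬝ᵥ x t ≤ v) (hge : v ≤ c ⬝ᵥ x (t + 1)) : v ≤ c (p t) := by
  have hstep : ((t : ℝ) + 1) * (c ⬝ᵥ x (t + 1)) = t * (c ⬝ᵥ x t) + c (p t) := by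
    simpa only [dotProduct_smul, dotProduct_add, smul_eq_mul, dotProduct_single, mul_one]
      using congrArg (c ⬝ᵥ ·) (hx t)
  have hle' : (t : ℝ) * (c ⬝ᵥ x t) ≤ t * v := by gcongr
  have hge' : ((t : ℝ) + 1) * v ≤ (t + 1) * (c ⬝ᵥ x (t + 1)) := by gcongr
  linarith

end IsEmpiricalMean

lemma IsFollowTheLeader.le_of_indifferent [Fintype ι] [DecidableEq ι] {c u x : ℕ → ι → ℝ}
    {p : ℕ → ι} (hu : IsFollowTheLeader c u p) (hx : IsEmpiricalMean p x) {v : ℝ} {t : ℕ}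
    (hle : c t ⬝ᵥ x t ≤ v) (hge : v ≤ c t ⬝ᵥ x (t + 1))
    (hind : ∀ i i', u (t + 1) i ≤ u (t + 1) i') (i : ι) : v ≤ c t i := by
  have hpi := hind (p t) i
  rw [hu.step, Pi.add_apply, Pi.add_apply] at hpi
  linarith [hx.le_apply_of_dotProduct_le hle hge, hu.best t i]

end FollowTheLeader

section Game

variable {n m : ℕ} {A : Matrix (Fin (n + 1)) (Fin (m + 1)) ℝ} {j₀ : Fin (m + 1)} {v : ℝ}

lemma lt_maxCoord_iff {w : Fin (n + 1) → ℝ} {a : ℝ} : a < maxCoord w ↔ ∃ i, a < w i := by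
  simp only [maxCoord, Finset.lt_sup'_iff, Finset.mem_univ, true_and]

lemma ne_zero_of_apply_lt_maxCoord {w : Fin (n + 1) → ℝ} {l : Fin (n + 1)}
    (hl : w l < maxCoord w) : n ≠ 0 := by
  rintro rfl
  obtain ⟨i, hi⟩ := lt_maxCoord_iff.1 hl
  exact hi.ne (congrArg w (Subsingleton.elim (α := Fin 1) l i))

lemma payoff_eq_dotProduct (x : Fin (n + 1) → ℝ) (y : Fin (m + 1) → ℝ) :
    payoff A x y = (fun j => column A j ⬝ᵥ x) ⬝ᵥ y := by
  rw [payoff, dotProduct_mulVec]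
  exact congrArg (· ⬝ᵥ y) (funext fun j => dotProduct_comm _ _)

lemma payoff_single (x : Fin (n + 1) → ℝ) (j : Fin (m + 1)) :
    payoff A x (Pi.single j 1) = column A j ⬝ᵥ x := by
  rw [payoff_eq_dotProduct, dotProduct_single, mul_one]

lemma mem_nashSet₁_of_mem_bestResponse₂ (hcol : column A j₀ = fun _ => v)
    {x : Fin (n + 1) → ℝ} (hx : x ∈ stdSimplex ℝ (Fin (n + 1))) (hj₀ : j₀ ∈ bestResponse₂ A x) :
    x ∈ nashSet₁ A := by
  refine ⟨Pi.single j₀ 1, hx, single_mem_stdSimplex ℝ j₀, fun x' hx' => ?_, fun y' hy' => ?_⟩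
  · rw [payoff_single, payoff_single, hcol, const_dotProduct_of_mem_stdSimplex hx,
      const_dotProduct_of_mem_stdSimplex hx']
  · rw [payoff_single, payoff_eq_dotProduct]
    exact le_dotProduct_of_mem_stdSimplex hy' hj₀

lemma FullyMixed.pos (hA : FullyMixed A) {x : Fin (n + 1) → ℝ} (hx : x ∈ nashSet₁ A)
    (l : Fin (n + 1)) : 0 < x l := by
  obtain ⟨y, hy⟩ := hx
  refine (hy.mem_left.1 l).lt_of_ne' fun h0 => ?_
  exact Set.eq_empty_iff_forall_notMem.1 hA x
    ⟨mem_intrinsicFrontier_stdSimplex hy.mem_left h0, y, hy⟩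

lemma FullyMixed.single_notMem_nashSet₁ (hA : FullyMixed A) (hn : n ≠ 0) (i : Fin (n + 1)) :
    Pi.single i 1 ∉ nashSet₁ A := by
  intro hnash
  have : Nontrivial (Fin (n + 1)) := Fin.nontrivial_iff_two_le.2 (by lia)
  obtain ⟨l, hl⟩ := exists_ne i
  exact (hA.pos hnash l).ne' (Pi.single_eq_of_ne hl 1)

lemma bestResponse₂_eq_of_mem_regionB {I : Finset (Fin (m + 1))} {z : Fin (n + 1) → ℝ}
    (hz : z ∈ regionB A I) : bestResponse₂ A z = I := by
  ext j
  refine ⟨fun hj => ?_, fun hj => (hz.2.1 j hj).2⟩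
  by_contra hjI
  exact hz.2.2 j hjI ⟨hz.1, hj⟩

lemma eventually_bestResponse₂_subset (A : Matrix (Fin (n + 1)) (Fin (m + 1)) ℝ)
    (z : Fin (n + 1) → ℝ) : ∀ᶠ x in 𝓝 z, bestResponse₂ A x ⊆ bestResponse₂ A z := by
  suffices ∀ j ∉ bestResponse₂ A z, ∀ᶠ x in 𝓝 z, j ∉ bestResponse₂ A x by
    have hall := eventually_all.2 fun j => eventually_imp_distrib_left.2 (this j)
    exact hall.mono fun x hx j => not_imp_not.1 (hx j)
  intro j hj
  obtain ⟨j', hj'⟩ : ∃ j', column A j' ⬝ᵥ z < column A j ⬝ᵥ z := by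
    simpa only [bestResponse₂, Set.mem_ofPred_eq, not_forall, not_le] using hj
  have hcont (i : Fin (m + 1)) : ContinuousAt (fun x => column A i ⬝ᵥ x) z :=
    (continuous_const.dotProduct continuous_id).continuousAt
  exact ((hcont j').eventually_lt (hcont j) hj').mono fun x hx hjx => hx.not_ge (hjx j')

end Game

section Play

variable {n m : ℕ} {A : Matrix (Fin (n + 1)) (Fin (m + 1)) ℝ} {j₀ : Fin (m + 1)} {v : ℝ}
  {x u : ℕ → Fin (n + 1) → ℝ} {p : ℕ → Fin (n + 1)} {q : ℕ → Fin (m + 1)}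

lemma IsFictitiousPlay.exists_isFollowTheLeader {k₂ : ℝ} {y : ℕ → Fin (m + 1) → ℝ}
    (h : IsFictitiousPlay A 0 k₂ x y) :
    ∃ (u : ℕ → Fin (n + 1) → ℝ) (p : ℕ → Fin (n + 1)) (q : ℕ → Fin (m + 1)),
      IsFollowTheLeader (fun k => column A (q k)) u p ∧ IsEmpiricalMean p x ∧
        ∀ k, q k ∈ bestResponse₂ A (x k) := by
  choose p hp hx using h.step₁
  choose q hq hy using h.step₂
  have hk₂ := h.nonneg₂
  refine ⟨fun k => ((k : ℝ) + k₂) • (A *ᵥ y k), p, q, ⟨fun k => ?_, fun k i => ?_⟩,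
    fun k => ?_, hq⟩
  · have hk : (k : ℝ) + k₂ + 1 ≠ 0 := by positivity
    rw [Nat.cast_add_one, add_right_comm, hy k, mulVec_smul, smul_inv_smul₀ hk, mulVec_add,
      mulVec_smul, mulVec_single_one]
    rfl
  · exact mul_le_mul_of_nonneg_left (hp k i) (by positivity)
  · have hk : (k : ℝ) + 1 ≠ 0 := by positivity
    rw [hx k, add_zero, smul_inv_smul₀ hk]

lemma exists_apply_lt_of_switch (hu : IsFollowTheLeader (fun k => column A (q k)) u p)
    (hx : IsEmpiricalMean p x) (hq : ∀ k, q k ∈ bestResponse₂ A (x k)) (hA : FullyMixed A)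
    (hcol : column A j₀ = fun _ => v) {t : ℕ} (ht : 1 ≤ t) (hqt : column A (q t) ≠ fun _ => v)
    (hqt' : column A (q (t + 1)) = fun _ => v) : ∃ l i, u (t + 1) l < u (t + 1) i := by
  by_contra! hind
  have hxt := hx.mem_stdSimplex ht
  have hle : column A (q t) ⬝ᵥ x t ≤ v :=
    (hq t j₀).trans_eq (hcol ▸ const_dotProduct_of_mem_stdSimplex hxt v)
  have hge : v ≤ column A (q t) ⬝ᵥ x (t + 1) := by
    have hbest := hq (t + 1) (q t)
    rwa [hqt', const_dotProduct_of_mem_stdSimplex (hx.mem_stdSimplex t.succ_pos)] at hbest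
  have hmin : ∀ i, v ≤ column A (q t) i := hu.le_of_indifferent hx hle hge fun i i' => hind i' i
  have hj₀ : j₀ ∈ bestResponse₂ A (x t) := fun j => by
    rw [hcol, const_dotProduct_of_mem_stdSimplex hxt]
    exact (le_dotProduct_of_mem_stdSimplex hxt hmin).trans (hq t j)
  have hpos := hA.pos (mem_nashSet₁_of_mem_bestResponse₂ hcol hxt hj₀)
  exact hqt (eq_const_of_dotProduct_le hxt hpos hmin hle)

lemma exists_eventually_ne_of_eventually_const
    (hu : IsFollowTheLeader (fun k => column A (q k)) u p) (hx : IsEmpiricalMean p x)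
    (hq : ∀ k, q k ∈ bestResponse₂ A (x k)) (hA : FullyMixed A) (hn : n ≠ 0)
    (hcol : column A j₀ = fun _ => v) (hconst : ∀ᶠ k in atTop, column A (q k) = fun _ => v) :
    ∃ l, ∀ᶠ k in atTop, p k ≠ l := by
  have hone : column A (q 1) ≠ fun _ => v := fun hq1 =>
    hA.single_notMem_nashSet₁ hn (p 0) <| hx.apply_one ▸
      mem_nashSet₁_of_mem_bestResponse₂ hq1 (hx.mem_stdSimplex le_rfl) (hq 1)
  obtain ⟨t, ht, hqt, hlast⟩ :=
    exists_last_of_eventually_not hone (hconst.mono fun k => not_not.2)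
  have hafter : ∀ k ≥ t + 1, column A (q k) = fun _ => v := fun k hk => not_not.1 (hlast k hk)
  obtain ⟨l, i, hli⟩ := exists_apply_lt_of_switch hu hx hq hA hcol ht hqt (hafter _ le_rfl)
  have hflat : ∀ k ≥ t + 1, ∀ i i', column A (q k) i = column A (q k) i' := fun k hk i i' => by
    rw [hafter k hk]
  exact ⟨l, (eventually_ge_atTop (t + 1)).mono (hu.ne_of_forall_const hflat hli)⟩

end Play

end ZeroSum

theorem mainTheorem2_general {n m : ℕ} {A : Matrix (Fin (n + 1)) (Fin (m + 1)) ℝ} (hn : n ≠ 0)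
    (hA : ZeroSum.FullyMixed A) {j₀ : Fin (m + 1)} {v : ℝ}
    (hcol : ZeroSum.column A j₀ = fun _ => v) {I : Finset (Fin (m + 1))} (hj₀ : j₀ ∈ I)
    (hl : ∃ l : Fin (n + 1), ∀ w ∈ convexHull ℝ (ZeroSum.column A '' {i | i ∈ I ∧ i ≠ j₀}),
      w l < ZeroSum.maxCoord w)
    {k₂ : ℝ} {x : ℕ → Fin (n + 1) → ℝ} {y : ℕ → Fin (m + 1) → ℝ}
    (hFP : ZeroSum.IsFictitiousPlay A 0 k₂ x y)
    {z : Fin (n + 1) → ℝ} (hz : z ∈ ZeroSum.regionB A I) : ¬ Tendsto x atTop (𝓝 z) := by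
  intro hlim
  obtain ⟨u, p, q, hu, hx, hq⟩ := hFP.exists_isFollowTheLeader
  have hI : ZeroSum.bestResponse₂ A z = I := ZeroSum.bestResponse₂_eq_of_mem_regionB hz
  have hpos : ∀ i, 0 < z i :=
    hA.pos (ZeroSum.mem_nashSet₁_of_mem_bestResponse₂ hcol hz.1 (hI ▸ hj₀))
  suffices ∃ i, ∀ᶠ k in atTop, p k ≠ i by
    obtain ⟨i, hi⟩ := this
    exact (hpos i).ne' (hx.apply_eq_zero_of_eventually_ne hlim hi)
  obtain ⟨l, hl⟩ := hl
  set C := convexHull ℝ (ZeroSum.column A '' {i | i ∈ I ∧ i ≠ j₀})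
  have hcols : ∀ᶠ k in atTop, ZeroSum.column A (q k) ∉ C → ZeroSum.column A (q k) = fun _ => v := by
    filter_upwards [hlim.eventually (ZeroSum.eventually_bestResponse₂_subset A z)] with k hk hqC
    have hqI : q k ∈ I := Finset.mem_coe.1 (hI ▸ hk (hq k))
    have hqj₀ : q k = j₀ := by_contra fun hne => hqC (subset_convexHull ℝ _ ⟨q k, ⟨hqI, hne⟩, rfl⟩)
    rw [hqj₀, hcol]
  by_cases hfreq : ∃ᶠ k in atTop, ZeroSum.column A (q k) ∈ C
  · have hC : IsCompact C := ((Set.toFinite _).image _).isCompact_convexHull ℝ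
    exact ⟨l, hu.eventually_ne_of_frequently_mem (convex_convexHull ℝ _) hC
      (fun w hw => ZeroSum.lt_maxCoord_iff.1 (hl w hw))
      (hcols.mono fun k hk hqC i i' => by rw [hk hqC]) hfreq⟩
  · exact ZeroSum.exists_eventually_ne_of_eventually_const hu hx hq hA hn hcol
      ((not_frequently.1 hfreq).mp hcols)

theorem mainTheorem2 {n m : ℕ} (A : Matrix (Fin (n + 1)) (Fin (m + 1)) ℝ)
    (hA1 : ZeroSum.PositiveMeasure A) (hA2 : ZeroSum.FullyMixed A)
    (hcol : ZeroSum.column A 0 = fun _ => ZeroSum.gameValue A)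
    (I : Finset (Fin (m + 1))) (h0I : 0 ∈ I) (hI : 2 ≤ I.card)
    (hl : ∃ l : Fin (n + 1), ∀ w ∈ convexHull ℝ (ZeroSum.column A '' {i | i ∈ I ∧ i ≠ 0}),
      w l < ZeroSum.maxCoord w)
    (k₂ : ℝ) (x : ℕ → Fin (n + 1) → ℝ) (y : ℕ → Fin (m + 1) → ℝ)
    (hFP : ZeroSum.IsFictitiousPlay A 0 k₂ x y)
    (xstar : Fin (n + 1) → ℝ) (hx : xstar ∈ ZeroSum.regionB A I) :
    ¬ Filter.Tendsto x Filter.atTop (nhds xstar) := by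
  obtain ⟨i, hi, hi0⟩ := Finset.exists_mem_ne hI 0
  have hn := ZeroSum.ne_zero_of_apply_lt_maxCoord
    (hl.choose_spec _ (subset_convexHull ℝ _ ⟨i, ⟨hi, hi0⟩, rfl⟩))
  exact mainTheorem2_general hn hA2 hcol h0I hl hFP hx
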